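/- For $\alpha,\beta>0$ let $E_{\alpha,\beta}(z)=\sum_{n=0}^{\infty}\frac{z^n}{\Gamma(\alpha n+\beta)}$ be the two-parametric Mittag-Leffler function. Let $1<\alpha<2$, $\beta>0$, and let $\theta$ be a real function on the unit sphere of $\mathbb{R}^N$. Then there is a constant $C>0$, depending only on $N$, $\alpha$, $\beta$ and $\theta$ (in particular independent of $\delta$, $k$ and $A$), such that the following holds. Let $\sigma\in C^\infty(\mathbb{R}^N\setminus\{0\};(0,\infty))$ be homogeneous of degree $k>0$, that is $\sigma(t\xi)=t^k\sigma(\xi)$ for $t>0$ and $\xi\ne0$, with $\sigma=\theta$ on the unit sphere, and suppose that $$\left|\partial^\gamma_\xi\sigma(\xi)\right|\le A\,|\xi|^{k-|\gamma|},\qquad \xi\neq 0,$$ for all multi-indices $\gamma\in(\mathbb{N}\cup\{0\})^N$ with $|\gamma|\le[N/2]+1$. If $\delta\ge 0$ and $$k\left(\frac{\beta}{\alpha}-\frac1\alpha\right)\le\delta<k,$$ then $\xi\mapsto|\xi|^\delta E_{\alpha,\beta}(-\sigma(\xi))$ is smooth on $\mathbb{R}^N\setminus\{0\}$ and $$\left|\partial^\gamma_\xi\left[|\xi|^\delta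 E_{\alpha,\beta}(-\sigma(\xi))\right]\right|\le C A\,|\xi|^{-|\gamma|},\qquad \xi\ne0,$$ for all multi-indices $\gamma$ with $|\gamma|\le[N/2]+1$. -/

import Mathlib

open scoped ContDiff

noncomputable section

/-- The two-parametric Mittag-Leffler function `E_{α,β}(z) = ∑ₙ zⁿ / Γ(α n + β)`. -/
def mittagLeffler (α β : ℝ) (z : ℂ) : ℂ :=
  ∑' n : ℕ, z ^ n / Complex.Gamma ((α * n + β : ℝ) : ℂ)

/-- The partial derivative `∂f/∂ξᵢ`. -/
def partialDeriv {N : ℕ} {F : Type*} [NormedAddCommGroup F] [NormedSpace ℝ F] (i : Fin N)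
    (f : EuclideanSpace ℝ (Fin N) → F) : EuclideanSpace ℝ (Fin N) → F :=
  fun ξ => lineDeriv ℝ f ξ (EuclideanSpace.single i (1 : ℝ))

/-- The derivative `∂^γ f = ∂₁^{γ₁} ⋯ ∂_N^{γ_N} f` of multi-index `γ`. -/
def multiDeriv {N : ℕ} {F : Type*} [NormedAddCommGroup F] [NormedSpace ℝ F] (γ : Fin N → ℕ)
    (f : EuclideanSpace ℝ (Fin N) → F) : EuclideanSpace ℝ (Fin N) → F :=
  (List.finRange N).foldr (fun i g => (partialDeriv i)^[γ i] g) f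

/-- The length `|γ| = γ₁ + ⋯ + γ_N` of a multi-index. -/
def multiLength {N : ℕ} (γ : Fin N → ℕ) : ℕ := ∑ i, γ i

/-- `σ` is (positively) homogeneous of degree `k` on `ℝ^N ∖ {0}`. -/
def HomogeneousOfDegree {N : ℕ} (k : ℝ) (σ : EuclideanSpace ℝ (Fin N) → ℝ) : Prop :=
  ∀ t : ℝ, 0 < t → ∀ ξ : EuclideanSpace ℝ (Fin N), ξ ≠ 0 → σ (t • ξ) = t ^ k * σ ξ

/-- `|∂^γ f(ξ)| ≤ B |ξ|^{d - |γ|}` for all `ξ ≠ 0` and all multi-indices `γ` with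
`|γ| ≤ [N/2] + 1`. -/
def SymbolBound {N : ℕ} {F : Type*} [NormedAddCommGroup F] [NormedSpace ℝ F] (d B : ℝ)
    (f : EuclideanSpace ℝ (Fin N) → F) : Prop :=
  ∀ γ : Fin N → ℕ, multiLength γ ≤ N / 2 + 1 → ∀ ξ : EuclideanSpace ℝ (Fin N), ξ ≠ 0 →
    ‖multiDeriv γ f ξ‖ ≤ B * ‖ξ‖ ^ (d - (multiLength γ : ℝ))

end

/-! In logarithmic coordinates the claim becomes a bound for one function on the real line. Write
`σ(ξ) = exp(k log|ξ| + φ(ξ))`, where `φ`, the logarithm of the angular part, depends only on `θ`.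
With `τ = δ/k ∈ [0, 1)` and `G(x) = exp(τx) E(-exp x)`, the function in question is `exp(-τφ) G(k
log|ξ| + φ)`.

All derivatives of `G` are bounded, uniformly in `τ`. Indeed `exp(s) E(-exp s)` is bounded on a
strip about the real axis (`exists_norm_exp_mul_mittagLeffler_le`), `E` is bounded on the unit disc,
and Cauchy's estimates apply. The strip bound comes from an integral over `Re t = 1` when `β > α +
1`; smaller `β` follow by a recursion lowering `β` by one. Here `α < 2` keeps `1 + exp(s) t^(-α)`
away from zero.

A dilation moves `ξ` to the unit sphere and produces `|ξ|^(-|γ|)`; the shift `k log|ξ|` inside `G`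
is harmless. The chain rule then costs at most a multiple of `(1 + k)^M`, `M = [N/2] + 1`. The
symbol bound pays for it: the pure derivatives of `σ` along an axis are falling factorials of `k`,
so `A` dominates a multiple of `(1 + k)^M` (`pow_mul_le_of_symbolBound`). -/

open MeasureTheory Set Filter Topology

open scoped ContDiff FourierTransform

/-! ### Holomorphic parameter integrals and a complex Laplace transform. -/

/-- An integral of holomorphic functions dominated by a fixed integrable function is holomorphic
in the parameter. -/
theorem differentiableOn_integral_of_dominated {X : Type*} [MeasurableSpace X] {μ : Measure X}
    {U : Set ℂ} (hU : IsOpen U) {F : ℂ → X → ℂ} {b : X → ℝ}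
    (hd : ∀ᵐ x ∂μ, DifferentiableOn ℂ (fun z => F z x) U)
    (hm : ∀ z ∈ U, AEStronglyMeasurable (F z) μ)
    (hb : ∀ᵐ x ∂μ, ∀ z ∈ U, ‖F z x‖ ≤ b x) (hbi : Integrable b μ) :
    DifferentiableOn ℂ (fun z => ∫ x, F z x ∂μ) U := by
  intro z₀ hz₀
  obtain ⟨R, hR, hRU⟩ := Metric.isOpen_iff.1 hU z₀ hz₀
  have hR2 : 0 < R / 2 := by positivity
  have hball : ∀ z ∈ Metric.ball z₀ (R / 2), Metric.closedBall z (R / 2) ⊆ U := by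
    intro z hz w hw
    apply hRU
    rw [Metric.mem_ball] at hz ⊢
    rw [Metric.mem_closedBall] at hw
    linarith [dist_triangle w z z₀]
  -- The derivative is measurable as a limit of difference quotients along a sequence `h n → 0`.
  have hmeas' : AEStronglyMeasurable (fun x => deriv (fun z => F z x) z₀) μ := by
    let h : ℕ → ℂ := fun n => ((R / 2 * (1 / ((n : ℝ) + 1)) : ℝ) : ℂ)
    have hpos : ∀ n : ℕ, 0 < R / 2 * (1 / ((n : ℝ) + 1)) := fun n => by positivity
    have hh0 : Tendsto h atTop (𝓝[≠] 0) := by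
      refine tendsto_nhdsWithin_iff.2 ⟨?_, Eventually.of_forall fun n => ?_⟩
      · have := (tendsto_one_div_add_atTop_nhds_zero_nat (𝕜 := ℝ)).const_mul (R / 2)
        rw [mul_zero] at this
        exact (Complex.continuous_ofReal.tendsto' 0 0 (by simp)).comp this
      · simpa [h, hR.ne'] using Complex.ofReal_ne_zero.2 (by positivity : ((n : ℝ) + 1) ≠ 0)
    refine aestronglyMeasurable_of_tendsto_ae (f := fun (n : ℕ) x =>
      (h n)⁻¹ • (F (z₀ + h n) x - F z₀ x)) atTop ?_ ?_
    · intro n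
      refine ((hm _ (hRU ?_)).sub (hm _ hz₀)).const_smul (h n)⁻¹
      have h1 : 1 / ((n : ℝ) + 1) ≤ 1 := by
        rw [div_le_one (by positivity)]
        linarith [n.cast_nonneg (α := ℝ)]
      have h2 : ‖h n‖ < R := by
        simp only [h]
        rw [Complex.norm_of_nonneg (hpos n).le]
        nlinarith
      simpa [Metric.mem_ball, dist_eq_norm] using h2
    · filter_upwards [hd] with x hx
      have := ((hx z₀ hz₀).differentiableAt (hU.mem_nhds hz₀)).hasDerivAt
      exact (hasDerivAt_iff_tendsto_slope_zero.1 this).comp hh0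
  refine (hasDerivAt_integral_of_dominated_loc_of_deriv_le
    (F' := fun z x => deriv (fun z => F z x) z) (bound := fun x => b x / (R / 2))
    (Metric.ball_mem_nhds z₀ hR2) ?_ ?_ hmeas' ?_ (hbi.div_const _) ?_
    ).2.differentiableAt.differentiableWithinAt
  · filter_upwards [hU.mem_nhds hz₀] with z hz using hm z hz
  · exact hbi.mono' (hm z₀ hz₀) (hb.mono fun x hx => hx z₀ hz₀)
  · filter_upwards [hd, hb] with x hdx hbx z hz
    refine Complex.norm_deriv_le_of_forall_mem_sphere_norm_le hR2 ?_ fun w hw =>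
      hbx w (hball z hz (Metric.sphere_subset_closedBall hw))
    refine DifferentiableOn.diffContOnCl (hdx.mono ?_)
    rw [closure_ball _ hR2.ne']
    exact hball z hz
  · filter_upwards [hd] with x hdx z hz
    have hzU := hball z hz (Metric.mem_closedBall_self hR2.le)
    exact ((hdx z hzU).differentiableAt (hU.mem_nhds hzU)).hasDerivAt

/-- The Laplace transform of `t ^ (p - 1)`, at a complex frequency. -/
theorem integral_cpow_mul_exp_neg_mul_Ioi_of_re_pos {p : ℝ} (hp : 0 < p) {r : ℂ}
    (hr : 0 < r.re) :
    ∫ t : ℝ in Ioi 0, (t : ℂ) ^ ((p : ℂ) - 1) * Complex.exp (-(r * t)) =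
      Complex.Gamma p * r ^ (-(p : ℂ)) := by
  -- On `Re z > c` the single function `t^(p-1) exp(-ct)` dominates every integrand.
  set c := r.re / 2 with hc
  have hc0 : 0 < c := by positivity
  set U : Set ℂ := {z | c < z.re} with hUdef
  have hU : IsOpen U := isOpen_lt continuous_const Complex.continuous_re
  have hUc : IsPreconnected U := (convex_halfSpace_re_gt c).isPreconnected
  have hL : DifferentiableOn ℂ (fun r : ℂ => ∫ t : ℝ in Ioi 0,
      (t : ℂ) ^ ((p : ℂ) - 1) * Complex.exp (-(r * t))) U := by
    refine differentiableOn_integral_of_dominated hU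
      (b := fun t : ℝ => t ^ (p - 1) * Real.exp (-c * t ^ (1 : ℝ))) ?_ ?_ ?_ ?_
    · exact Eventually.of_forall fun t => by fun_prop
    · intro z hz
      refine ContinuousOn.aestronglyMeasurable ?_ measurableSet_Ioi
      refine ContinuousOn.mul ?_ (by fun_prop)
      intro t ht
      exact ((continuousAt_cpow_const (Or.inl (by simpa using ht))).comp
        Complex.continuous_ofReal.continuousAt).continuousWithinAt
    · filter_upwards [ae_restrict_mem measurableSet_Ioi] with t ht z hz
      have ht0 : 0 < t := ht
      rw [norm_mul, Complex.norm_cpow_eq_rpow_re_of_pos ht0, Complex.norm_exp]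
      simp only [Complex.sub_re, Complex.ofReal_re, Complex.one_re, Complex.neg_re,
        Complex.mul_re, Complex.ofReal_im, mul_zero, sub_zero, Real.rpow_one, neg_mul]
      have hz' : c < z.re := hz
      gcongr
    · exact integrableOn_rpow_mul_exp_neg_mul_rpow (by linarith) one_pos hc0
  have hG : DifferentiableOn ℂ (fun r : ℂ => Complex.Gamma p * r ^ (-(p : ℂ))) U := by
    intro z hz
    have hz' : c < z.re := hz
    refine (DifferentiableAt.const_mul ?_ _).differentiableWithinAt
    exact differentiableAt_id.cpow_const (Or.inl (by simp only [id]; linarith))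
  -- Identity theorem: the formula is known at the real frequencies `c + 1 + 1/(n+1)`, which
  -- accumulate at `c + 1`.
  refine AnalyticOnNhd.eqOn_of_preconnected_of_frequently_eq (z₀ := ((c + 1 : ℝ) : ℂ))
    (hL.analyticOnNhd hU) (hG.analyticOnNhd hU) hUc
    (by simp only [hUdef, mem_ofPred_eq, Complex.ofReal_re]; linarith) ?_
    (by simp only [hUdef, mem_ofPred_eq]; linarith)
  have htend : Tendsto (fun n : ℕ => ((c + 1 + 1 / ((n : ℝ) + 1) : ℝ) : ℂ)) atTop
      (𝓝[≠] ((c + 1 : ℝ) : ℂ)) := by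
    refine tendsto_nhdsWithin_iff.2 ⟨?_, Eventually.of_forall fun n => ?_⟩
    · have := (tendsto_one_div_add_atTop_nhds_zero_nat (𝕜 := ℝ)).const_add (c + 1)
      rw [add_zero] at this
      exact (Complex.continuous_ofReal.tendsto _).comp this
    · have : (0 : ℝ) < 1 / ((n : ℝ) + 1) := by positivity
      simp only [mem_compl_iff, mem_singleton_iff, Complex.ofReal_inj]
      linarith
  refine htend.frequently (Eventually.of_forall fun n => ?_).frequently
  have hx : 0 < c + 1 + 1 / ((n : ℝ) + 1) := by positivity
  rw [Complex.integral_cpow_mul_exp_neg_mul_Ioi (by simpa using hp) hx, one_div,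
    Complex.inv_cpow _ _ (by rw [Complex.arg_ofReal_of_nonneg hx.le]; exact Real.pi_pos.ne),
    Complex.cpow_neg, mul_comm]

/-! ### The line `Re t = 1` and the reciprocal Gamma function. -/

/-- The parametrization `w ↦ 1 + 2πiw` of the vertical line `Re t = 1`. -/
noncomputable def verticalLine (w : ℝ) : ℂ := 1 + 2 * Real.pi * w * Complex.I

theorem verticalLine_re (w : ℝ) : (verticalLine w).re = 1 := by
  simp [verticalLine]

theorem verticalLine_ne_zero (w : ℝ) : verticalLine w ≠ 0 := fun h => by
  simpa [h] using verticalLine_re w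

theorem verticalLine_mem_slitPlane (w : ℝ) : verticalLine w ∈ Complex.slitPlane :=
  Or.inl (by rw [verticalLine_re]; exact one_pos)

theorem one_le_norm_verticalLine (w : ℝ) : 1 ≤ ‖verticalLine w‖ := by
  simpa [verticalLine_re] using Complex.abs_re_le_norm (verticalLine w)

theorem norm_exp_verticalLine (w : ℝ) : ‖Complex.exp (verticalLine w)‖ = Real.exp 1 := by
  rw [Complex.norm_exp, verticalLine_re]

theorem continuous_verticalLine : Continuous verticalLine := by
  unfold verticalLine; fun_prop

theorem norm_verticalLine_cpow (w p : ℝ) :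
    ‖verticalLine w ^ (p : ℂ)‖ = ‖verticalLine w‖ ^ p :=
  Complex.norm_cpow_of_ne_zero (verticalLine_ne_zero w) _ |>.trans (by simp)

theorem continuous_verticalLine_cpow (p : ℂ) : Continuous fun w => verticalLine w ^ p :=
  continuous_verticalLine.cpow continuous_const fun w => verticalLine_mem_slitPlane w

theorem integrable_norm_verticalLine_rpow {p : ℝ} (hp : 1 < p) :
    Integrable fun w => ‖verticalLine w‖ ^ (-p) := by
  have h := (integrable_rpow_neg_one_add_norm_sq (E := ℝ) (μ := volume) (r := p)
    (by simpa using hp)).comp_mul_left' (R := 2 * Real.pi) (by positivity)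
  refine h.congr (Eventually.of_forall fun w => ?_)
  have hn : ‖verticalLine w‖ = (1 + ‖2 * Real.pi * w‖ ^ 2) ^ ((1 : ℝ) / 2) := by
    rw [← Real.sqrt_eq_rpow, Complex.norm_def, Complex.normSq_apply]
    congr 1
    simp [verticalLine, mul_pow]
    ring
  simp only
  rw [hn, ← Real.rpow_mul (by positivity)]
  congr 1
  ring

theorem integrable_verticalLine_cpow {p : ℝ} (hp : 1 < p) :
    Integrable fun w => verticalLine w ^ (-(p : ℂ)) := by
  refine (integrable_norm_verticalLine_rpow hp).mono'
    (continuous_verticalLine_cpow _).aestronglyMeasurable (Eventually.of_forall fun w => ?_)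
  rw [← Complex.ofReal_neg, norm_verticalLine_cpow]

/-- Laplace's integral for the reciprocal Gamma function. -/
theorem inv_Gamma_eq_integral_verticalLine {p : ℝ} (hp : 1 < p) :
    (Complex.Gamma p)⁻¹ =
      ∫ w, Complex.exp (verticalLine w) * verticalLine w ^ (-(p : ℂ)) := by
  have hG : Complex.Gamma p ≠ 0 := Complex.Gamma_ne_zero_of_re_pos (by simp; linarith)
  -- The Fourier transform of this `f` is `Γ(p) (1 + 2πiw)^(-p)`; Fourier inversion at `t = 1` gives
  -- the formula.
  let f : ℝ → ℂ := (Ioi 0).indicator fun t : ℝ => (t : ℂ) ^ ((p : ℂ) - 1) * Complex.exp (-t)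
  have hfi : Integrable f := by
    have := Complex.GammaIntegral_convergent (s := p) (by simp; linarith)
    rw [integrable_indicator_iff measurableSet_Ioi]
    refine this.congr_fun (fun t _ => ?_) measurableSet_Ioi
    simp [mul_comm]
  have hF : 𝓕 f = fun w => Complex.Gamma p * verticalLine w ^ (-(p : ℂ)) := by
    ext w
    rw [Real.fourier_real_eq_integral_exp_smul,
      ← integral_cpow_mul_exp_neg_mul_Ioi_of_re_pos (by linarith)
        (by rw [verticalLine_re]; exact one_pos), ← integral_indicator measurableSet_Ioi]
    congr 1
    ext t
    by_cases ht : t ∈ Ioi (0 : ℝ)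
    · simp only [f, indicator_of_mem ht, smul_eq_mul]
      rw [mul_left_comm, ← Complex.exp_add]
      congr 2
      simp [verticalLine]
      ring
    · simp [f, indicator_of_notMem ht]
  have hFi : Integrable (𝓕 f) := by
    rw [hF]; exact (integrable_verticalLine_cpow hp).const_mul _
  have hc : ContinuousAt f 1 := by
    have h1 : ContinuousAt (fun t : ℝ => (t : ℂ) ^ ((p : ℂ) - 1) * Complex.exp (-t)) 1 := by
      refine ContinuousAt.mul ?_ (by fun_prop)
      exact (continuousAt_cpow_const (Or.inl (by simp))).comp
        Complex.continuous_ofReal.continuousAt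
    refine h1.congr ?_
    filter_upwards [Ioi_mem_nhds (one_pos : (0 : ℝ) < 1)] with t ht
    simp only [f, indicator_of_mem ht]
  have hinv := hfi.fourierInv_fourier_eq hFi hc
  rw [Real.fourierInv_eq', hF] at hinv
  have h1 : f 1 = Complex.exp (-1) := by simp [f]
  rw [h1] at hinv
  rw [inv_eq_iff_eq_inv, eq_comm, inv_eq_iff_eq_inv, eq_comm, ← one_div, div_eq_iff hG]
  calc (1 : ℂ) = Complex.exp 1 * Complex.exp (-1) := by rw [← Complex.exp_add]; simp
    _ = _ := by
      rw [← hinv, ← integral_const_mul, ← integral_mul_const]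
      congr 1
      ext w
      have : Complex.exp (verticalLine w)
          = Complex.exp 1 * Complex.exp (2 * Real.pi * w * Complex.I) := by
        rw [← Complex.exp_add, verticalLine]
      rw [this]
      simp
      ring

/-! ### The Mittag-Leffler series. -/

theorem Complex.Gamma_ofReal_ne_zero_of_pos {x : ℝ} (hx : 0 < x) : Complex.Gamma x ≠ 0 :=
  Complex.Gamma_ne_zero_of_re_pos (by simpa using hx)

theorem summable_pow_div_norm_Gamma {α β : ℝ} (hα : 1 < α) (hβ : 0 < β) (R : ℝ) :
    Summable fun n : ℕ => R ^ n / ‖Complex.Gamma ((α * n + β : ℝ) : ℂ)‖ := by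
  refine Summable.of_norm_bounded_eventually_nat (Real.summable_pow_div_factorial |R|) ?_
  obtain ⟨m, hm⟩ := exists_nat_ge (1 / (α - 1))
  -- Past `1/(α-1)` one has `αn + β ≥ n + 1`; `n ≥ 1` puts both arguments in `[2, ∞)`, where Gamma
  -- increases, so Gamma is at least `n!`.
  filter_upwards [eventually_ge_atTop (max m 1)] with n hn
  have hn1 : (1 : ℝ) ≤ n := by exact_mod_cast (le_max_right m 1).trans hn
  have hnm : (m : ℝ) ≤ n := by exact_mod_cast (le_max_left m 1).trans hn
  have h1 : 1 ≤ (α - 1) * n := by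
    have := hm.trans hnm
    rwa [div_le_iff₀' (by linarith)] at this
  have hle : (n : ℝ) + 1 ≤ α * n + β := by linarith
  have hG : (n.factorial : ℝ) ≤ Real.Gamma (α * n + β) := by
    rw [← Real.Gamma_nat_eq_factorial]
    exact Real.Gamma_strictMonoOn_Ici.monotoneOn (by simp only [mem_Ici]; linarith)
      (by simp only [mem_Ici]; linarith) hle
  rw [Complex.Gamma_ofReal, Complex.norm_real, norm_div, norm_pow, norm_norm, Real.norm_eq_abs]
  gcongr
  exact hG.trans (le_abs_self _)

theorem norm_mittagLeffler_term_le {α β R : ℝ} {z : ℂ} (hz : ‖z‖ ≤ R) (n : ℕ) :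
    ‖z ^ n / Complex.Gamma ((α * n + β : ℝ) : ℂ)‖ ≤
      R ^ n / ‖Complex.Gamma ((α * n + β : ℝ) : ℂ)‖ := by
  rw [norm_div, norm_pow]
  gcongr

theorem hasSum_mittagLeffler {α β : ℝ} (hα : 1 < α) (hβ : 0 < β) (z : ℂ) :
    HasSum (fun n : ℕ => z ^ n / Complex.Gamma ((α * n + β : ℝ) : ℂ)) (mittagLeffler α β z) :=
  (Summable.of_norm_bounded (summable_pow_div_norm_Gamma hα hβ ‖z‖)
    (norm_mittagLeffler_term_le le_rfl)).hasSum

theorem differentiable_mittagLeffler {α β : ℝ} (hα : 1 < α) (hβ : 0 < β) :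
    Differentiable ℂ (mittagLeffler α β) := by
  intro z
  have h := Complex.differentiableOn_tsum_of_summable_norm
    (F := fun (n : ℕ) (z : ℂ) => z ^ n / Complex.Gamma ((α * n + β : ℝ) : ℂ))
    (summable_pow_div_norm_Gamma hα hβ (‖z‖ + 1))
    (fun n => by fun_prop) Metric.isOpen_ball
    (U := Metric.ball 0 (‖z‖ + 1))
    (fun n w hw => norm_mittagLeffler_term_le (by simpa using (mem_ball_zero_iff.1 hw).le) n)
  exact h.differentiableAt (Metric.isOpen_ball.mem_nhds (by simp))

/-- The relation between the Mittag-Leffler functions with second parameters `β` and `β + 1`. -/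
theorem mittagLeffler_eq_add_deriv {α β : ℝ} (hα : 1 < α) (hβ : 0 < β) (z : ℂ) :
    mittagLeffler α β z =
      β * mittagLeffler α (β + 1) z + α * (z * deriv (mittagLeffler α (β + 1)) z) := by
  have hβ' : 0 < β + 1 := by linarith
  have hd := Complex.hasSum_deriv_of_summable_norm
    (F := fun (n : ℕ) (z : ℂ) => z ^ n / Complex.Gamma ((α * n + (β + 1) : ℝ) : ℂ))
    (summable_pow_div_norm_Gamma hα hβ' (‖z‖ + 1))
    (fun n => by fun_prop) Metric.isOpen_ball
    (U := Metric.ball 0 (‖z‖ + 1))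
    (fun n w hw => norm_mittagLeffler_term_le (by simpa using (mem_ball_zero_iff.1 hw).le) n)
    (z := z) (by simp)
  have hs := ((hasSum_mittagLeffler hα hβ' z).mul_left (β : ℂ)).add
    ((hd.mul_left z).mul_left (α : ℂ))
  refine (hasSum_mittagLeffler hα hβ z).unique (hs.congr_fun ?_)
  intro n
  have hx : 0 < α * n + β := by positivity
  have hG : Complex.Gamma ((α * n + (β + 1) : ℝ) : ℂ) =
      ((α * n + β : ℝ) : ℂ) * Complex.Gamma ((α * n + β : ℝ) : ℂ) := by
    rw [← Complex.Gamma_add_one _ (by exact_mod_cast hx.ne')]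
    congr 1
    push_cast
    ring
  have hG0 := Complex.Gamma_ofReal_ne_zero_of_pos hx
  have hx0 : ((α * n + β : ℝ) : ℂ) ≠ 0 := by exact_mod_cast hx.ne'
  have hzn : z * (n * z ^ (n - 1)) = n * z ^ n := by
    rcases n with _ | n
    · simp
    · simp [pow_succ]; ring
  rw [deriv_div_const, deriv_pow_field, ← mul_div_assoc z, hzn, hG]
  field_simp
  push_cast
  ring

/-! ### Integral representation of `E(-exp s)` on a strip. -/

/-- With `x = |exp u|`, the squared norm is at least `1 + x² + 2x cos ψ`, which is both `sin²ψ + (x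
+ cos ψ)²` and `x² sin²ψ + (1 + x cos ψ)²`. The first bound gives convergence of the integral
representation, the second its decay in `exp s`. -/
theorem sin_le_norm_one_add_exp {ψ : ℝ} {u : ℂ} (hψ : Real.pi / 2 ≤ ψ) (hψ' : ψ < Real.pi)
    (hu : |u.im| ≤ ψ) :
    Real.sin ψ ≤ ‖1 + Complex.exp u‖ ∧
      Real.sin ψ * ‖Complex.exp u‖ ≤ ‖1 + Complex.exp u‖ := by
  have hcos : Real.cos ψ ≤ Real.cos u.im := by
    rw [← Real.cos_abs u.im]
    exact Real.cos_le_cos_of_nonneg_of_le_pi (abs_nonneg _) hψ'.le hu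
  have hcos0 : Real.cos ψ ≤ 0 := Real.cos_nonpos_of_pi_div_two_le_of_le hψ (by linarith [Real.pi_pos])
  have hsq := Real.sin_sq_add_cos_sq ψ
  have hsq' := Real.sin_sq_add_cos_sq u.im
  have hp : 0 < Real.exp u.re := Real.exp_pos _
  have hnorm : ‖1 + Complex.exp u‖ ^ 2 =
      1 + Real.exp u.re ^ 2 + 2 * Real.exp u.re * Real.cos u.im := by
    rw [Complex.sq_norm, Complex.normSq_apply]
    simp only [Complex.add_re, Complex.one_re, Complex.exp_re, Complex.add_im, Complex.one_im,
      Complex.exp_im]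
    linear_combination (Real.exp u.re ^ 2) * hsq'
  have hmul := mul_le_mul_of_nonneg_left hcos hp.le
  constructor
  · refine le_of_sq_le_sq ?_ (norm_nonneg _)
    rw [hnorm]
    nlinarith [sq_nonneg (Real.exp u.re + Real.cos ψ)]
  · refine le_of_sq_le_sq ?_ (norm_nonneg _)
    rw [hnorm, Complex.norm_exp, mul_pow]
    nlinarith [sq_nonneg (1 + Real.exp u.re * Real.cos ψ)]

theorem abs_im_log_verticalLine_le (w : ℝ) :
    |(Complex.log (verticalLine w)).im| ≤ Real.pi / 2 := by
  rw [Complex.log_im, Complex.abs_arg_le_pi_div_two_iff, verticalLine_re]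
  exact zero_le_one

theorem continuous_log_verticalLine : Continuous fun w => Complex.log (verticalLine w) :=
  continuous_verticalLine.clog verticalLine_mem_slitPlane

theorem norm_exp_mul_log_verticalLine (p w : ℝ) :
    ‖Complex.exp (p * Complex.log (verticalLine w))‖ = ‖verticalLine w‖ ^ p := by
  rw [← norm_verticalLine_cpow, Complex.cpow_def_of_ne_zero (verticalLine_ne_zero w), mul_comm]

theorem abs_im_sub_log_verticalLine_le {α ε : ℝ} (hα : 0 ≤ α) {s : ℂ} (hs : |s.im| ≤ ε) (w : ℝ) :
    |(s - α * Complex.log (verticalLine w)).im| ≤ α * (Real.pi / 2) + ε := by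
  have h1 : (s - α * Complex.log (verticalLine w)).im =
      s.im - α * (Complex.log (verticalLine w)).im := by simp
  rw [h1]
  refine (abs_sub _ _).trans ?_
  rw [abs_mul, abs_of_nonneg hα]
  nlinarith [abs_im_log_verticalLine_le w]

/-- The integrand of the representation of `E_{α,β}(-exp s)` on the line `Re t = 1`. -/
noncomputable def mittagLefflerIntegrand (α β : ℝ) (s : ℂ) (w : ℝ) : ℂ :=
  Complex.exp (verticalLine w) * Complex.exp ((-β : ℝ) * Complex.log (verticalLine w)) /
    (1 + Complex.exp (s - α * Complex.log (verticalLine w)))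

/-- For `Re s < 0` the quotient is a geometric series of ratio at most `exp(Re s) < 1` on the line;
integrating it termwise yields the values `1/Γ(αn + β)`. -/
theorem mittagLeffler_neg_exp_eq_integral_of_re_neg {α β : ℝ} (hα : 1 < α) (hβ : 1 < β) {s : ℂ}
    (hs : s.re < 0) :
    mittagLeffler α β (-Complex.exp s) = ∫ w, mittagLefflerIntegrand α β s w := by
  set q : ℝ := Real.exp s.re with hq
  have hq0 : 0 < q := Real.exp_pos _
  have hq1 : q < 1 := by rw [hq, ← Real.exp_zero]; exact Real.exp_lt_exp.2 hs
  let F : ℕ → ℝ → ℂ := fun n w =>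
    Complex.exp (verticalLine w) * Complex.exp ((-β : ℝ) * Complex.log (verticalLine w)) *
      (-Complex.exp (s - α * Complex.log (verticalLine w))) ^ n
  have hlog := continuous_log_verticalLine
  have hvl := continuous_verticalLine
  have hFc : ∀ n, Continuous (F n) := fun n => by fun_prop
  have hnorm : ∀ w, ‖Complex.exp (s - α * Complex.log (verticalLine w))‖ ≤ q := by
    intro w
    rw [sub_eq_add_neg, Complex.exp_add, norm_mul, ← neg_mul, ← Complex.ofReal_neg,
      norm_exp_mul_log_verticalLine, Complex.norm_exp]
    exact mul_le_of_le_one_right hq0.le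
      (Real.rpow_le_one_of_one_le_of_nonpos (one_le_norm_verticalLine w) (by linarith))
  have hFb : ∀ n w, ‖F n w‖ ≤ q ^ n * (Real.exp 1 * ‖verticalLine w‖ ^ (-β)) := by
    intro n w
    simp only [F]
    rw [norm_mul, norm_mul, norm_exp_verticalLine, norm_exp_mul_log_verticalLine, norm_pow,
      norm_neg, mul_comm]
    gcongr
    exact hnorm w
  have hbi := (integrable_norm_verticalLine_rpow hβ).const_mul (Real.exp 1)
  have hFi : ∀ n, Integrable (F n) := fun n =>
    (hbi.const_mul (q ^ n)).mono' (hFc n).aestronglyMeasurable (Eventually.of_forall (hFb n))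
  have hsum : Summable fun n => ∫ w, ‖F n w‖ := by
    refine Summable.of_nonneg_of_le (fun n => integral_nonneg fun w => norm_nonneg _) (fun n => ?_)
      ((summable_geometric_of_lt_one hq0.le hq1).mul_right
        (∫ w, Real.exp 1 * ‖verticalLine w‖ ^ (-β)))
    rw [← integral_const_mul]
    exact integral_mono (hFi n).norm (hbi.const_mul _) (hFb n)
  have key := hasSum_integral_of_summable_integral_norm hFi hsum
  have hval : ∀ w, ∑' n, F n w = mittagLefflerIntegrand α β s w := by
    intro w
    simp only [F, mittagLefflerIntegrand]
    rw [tsum_mul_left, tsum_geometric_of_norm_lt_one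
      (by rw [norm_neg]; exact (hnorm w).trans_lt hq1), sub_neg_eq_add, div_eq_mul_inv]
  simp_rw [hval] at key
  refine (hasSum_mittagLeffler hα (by linarith) _).unique (key.congr_fun fun n => ?_)
  have hp : 1 < α * n + β := by
    have : 0 ≤ α * n := by positivity
    linarith
  rw [div_eq_mul_inv, inv_Gamma_eq_integral_verticalLine hp, ← integral_const_mul]
  congr 1
  ext w
  simp only [F]
  rw [Complex.cpow_def_of_ne_zero (verticalLine_ne_zero w), sub_eq_add_neg, Complex.exp_add,
    neg_mul_eq_neg_mul, mul_pow, ← Complex.exp_nat_mul (-(α * Complex.log (verticalLine w)))]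
  have : Complex.exp (Complex.log (verticalLine w) * -((α * n + β : ℝ) : ℂ)) =
      Complex.exp ((-β : ℝ) * Complex.log (verticalLine w)) *
        Complex.exp (n * -(α * Complex.log (verticalLine w))) := by
    rw [← Complex.exp_add]
    congr 1
    push_cast
    ring
  rw [this]
  ring

theorem isPreconnected_strip (ε : ℝ) : IsPreconnected {s : ℂ | |s.im| < ε} := by
  have h : {s : ℂ | |s.im| < ε} = Complex.imLm ⁻¹' Ioo (-ε) ε := by
    ext s; simp [abs_lt]
  rw [h]
  exact ((convex_Ioo (-ε) ε).linear_preimage Complex.imLm).isPreconnected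

theorem isOpen_strip (ε : ℝ) : IsOpen {s : ℂ | |s.im| < ε} :=
  isOpen_lt Complex.continuous_im.abs continuous_const

/-- The integral representation of `E_{α,β}(-exp s)` on a strip around the real axis. -/
theorem mittagLeffler_neg_exp_eq_integral {α β ε : ℝ} (hα : 1 < α) (hβ : 1 < β)
    (hε : 0 < ε) (hαε : α * (Real.pi / 2) + ε < Real.pi) {s : ℂ} (hs : |s.im| < ε) :
    mittagLeffler α β (-Complex.exp s) = ∫ w, mittagLefflerIntegrand α β s w := by
  set ψ := α * (Real.pi / 2) + ε with hψ
  have hψ2 : Real.pi / 2 ≤ ψ := by nlinarith [Real.pi_pos]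
  have hsin : 0 < Real.sin ψ := Real.sin_pos_of_pos_of_lt_pi (by linarith [Real.pi_pos]) hαε
  have hlog := continuous_log_verticalLine
  have hvl := continuous_verticalLine
  have hlow : ∀ s : ℂ, |s.im| < ε → ∀ w,
      Real.sin ψ ≤ ‖1 + Complex.exp (s - α * Complex.log (verticalLine w))‖ := fun s hs w =>
    (sin_le_norm_one_add_exp hψ2 hαε
      (abs_im_sub_log_verticalLine_le (by linarith) hs.le w)).1
  have hne : ∀ s : ℂ, |s.im| < ε → ∀ w,
      1 + Complex.exp (s - α * Complex.log (verticalLine w)) ≠ 0 := fun s hs w =>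
    norm_pos_iff.1 (hsin.trans_le (hlow s hs w))
  have hJ : DifferentiableOn ℂ (fun s => ∫ w, mittagLefflerIntegrand α β s w)
      {s : ℂ | |s.im| < ε} := by
    refine differentiableOn_integral_of_dominated (isOpen_strip ε)
      (b := fun w => Real.exp 1 * ‖verticalLine w‖ ^ (-β) / Real.sin ψ) ?_ ?_ ?_ ?_
    · refine Eventually.of_forall fun w s hs => ?_
      unfold mittagLefflerIntegrand
      refine DifferentiableAt.differentiableWithinAt ?_
      refine DifferentiableAt.fun_div ?_ ?_ (hne s hs w) <;> fun_prop
    · intro s hs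
      unfold mittagLefflerIntegrand
      exact (Continuous.div (by fun_prop) (by fun_prop) (hne s hs)).aestronglyMeasurable
    · refine Eventually.of_forall fun w s hs => ?_
      rw [mittagLefflerIntegrand, norm_div, norm_mul, norm_exp_verticalLine,
        norm_exp_mul_log_verticalLine]
      gcongr
      exact hlow s hs w
    · exact ((integrable_norm_verticalLine_rpow hβ).const_mul _).div_const _
  have hE : DifferentiableOn ℂ (fun s => mittagLeffler α β (-Complex.exp s))
      {s : ℂ | |s.im| < ε} :=
    ((differentiable_mittagLeffler hα (by linarith)).comp
      Complex.differentiable_exp.neg).differentiableOn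
  -- Both sides are holomorphic on the connected strip and agree near `-1`, where `Re s < 0`.
  refine (hE.analyticOnNhd (isOpen_strip ε)).eqOn_of_preconnected_of_eventuallyEq
    (hJ.analyticOnNhd (isOpen_strip ε)) (isPreconnected_strip ε) (z₀ := -1) (by simpa using hε)
    ?_ hs
  filter_upwards [(isOpen_lt Complex.continuous_re continuous_const).mem_nhds
    (by simp : (-1 : ℂ) ∈ {z : ℂ | z.re < 0})] with s hs
  exact mittagLeffler_neg_exp_eq_integral_of_re_neg hα hβ hs

/-! ### Boundedness of `exp(s) E(-exp s)` on a strip. -/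

theorem exists_norm_exp_mul_mittagLeffler_le_of_large {α β : ℝ} (hα : 1 < α) (hα' : α < 2)
    (hβ : α + 1 < β) :
    ∃ ε > 0, ∃ C, ∀ s : ℂ, |s.im| < ε →
      ‖Complex.exp s * mittagLeffler α β (-Complex.exp s)‖ ≤ C := by
  -- Half the gap between `απ/2` and `π`.
  set ε := Real.pi * (2 - α) / 4 with hεdef
  have hε : 0 < ε := by have := Real.pi_pos; positivity [sub_pos.2 hα']
  have hαε : α * (Real.pi / 2) + ε < Real.pi := by nlinarith [Real.pi_pos]
  set ψ := α * (Real.pi / 2) + ε with hψ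
  have hψ2 : Real.pi / 2 ≤ ψ := by nlinarith [Real.pi_pos]
  have hsin : 0 < Real.sin ψ := Real.sin_pos_of_pos_of_lt_pi (by linarith [Real.pi_pos]) hαε
  refine ⟨ε, hε, ∫ w, Real.exp 1 * ‖verticalLine w‖ ^ (-(β - α)) / Real.sin ψ, fun s hs => ?_⟩
  rw [mittagLeffler_neg_exp_eq_integral hα (by linarith) hε hαε hs, ← integral_const_mul]
  refine norm_integral_le_of_norm_le
    (((integrable_norm_verticalLine_rpow (by linarith)).const_mul _).div_const _)
    (Eventually.of_forall fun w => ?_)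
  have hlow := (sin_le_norm_one_add_exp hψ2 hαε
      (abs_im_sub_log_verticalLine_le (by linarith : 0 ≤ α) hs.le w)).2
  set L := Complex.log (verticalLine w) with hL
  -- The factor `exp(s) t^(-α)` is absorbed by the denominator; the remaining `t^(-(β-α))` is
  -- integrable since `β - α > 1`.
  have hEs : Complex.exp s * Complex.exp ((-β : ℝ) * L) =
      Complex.exp ((-(β - α) : ℝ) * L) * Complex.exp (s - α * L) := by
    rw [← Complex.exp_add, ← Complex.exp_add]
    congr 1
    push_cast
    ring
  have hpos : 0 < ‖1 + Complex.exp (s - α * L)‖ :=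
    lt_of_lt_of_le (mul_pos hsin (by simp)) hlow
  rw [mittagLefflerIntegrand, ← hL, ← mul_div_assoc, mul_left_comm, hEs, norm_div, norm_mul,
    norm_mul, norm_exp_verticalLine, hL, norm_exp_mul_log_verticalLine, ← hL,
    div_le_div_iff₀ hpos hsin, mul_assoc, mul_assoc, mul_assoc]
  gcongr
  rwa [mul_comm]

/-- In a sector around the negative axis, `z E_{α,β}(z)` is bounded. -/
theorem exists_norm_exp_mul_mittagLeffler_le {α β : ℝ} (hα : 1 < α) (hα' : α < 2) (hβ : 0 < β) :
    ∃ ε > 0, ∃ C, ∀ s : ℂ, |s.im| < ε →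
      ‖Complex.exp s * mittagLeffler α β (-Complex.exp s)‖ ≤ C := by
  -- `m` bounds how many unit increases bring `β` above `α + 1`; the induction generalizes over `β`.
  obtain ⟨m, hm⟩ := exists_nat_gt (α + 1 - β)
  induction m generalizing β with
  | zero =>
    exact exists_norm_exp_mul_mittagLeffler_le_of_large hα hα' (by simp at hm; linarith)
  | succ m ih =>
    obtain ⟨ε, hε, C, hC⟩ := ih (β := β + 1) (by linarith) (by push_cast at hm; linarith)
    -- On the half-width strip, discs of radius `ε/4` stay in the old strip, so Cauchy bounds `K'`.
    -- The recursion in `β` reads `βK + α(K' - K)`.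
    refine ⟨ε / 2, by positivity, β * C + α * (C / (ε / 4) + C), fun s hs => ?_⟩
    set E := mittagLeffler α (β + 1) with hE
    have hEd : Differentiable ℂ E := differentiable_mittagLeffler hα (by linarith)
    let K : ℂ → ℂ := fun s => Complex.exp s * E (-Complex.exp s)
    have hKd : Differentiable ℂ K :=
      Complex.differentiable_exp.mul (hEd.comp Complex.differentiable_exp.neg)
    have hK : deriv K s = K s + Complex.exp s * (deriv E (-Complex.exp s) * -Complex.exp s) :=
      ((Complex.hasDerivAt_exp s).mul
        ((hEd _).hasDerivAt.comp s (Complex.hasDerivAt_exp s).neg)).deriv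
    have hKb : ‖deriv K s‖ ≤ C / (ε / 4) := by
      refine Complex.norm_deriv_le_of_forall_mem_sphere_norm_le (by positivity)
        hKd.diffContOnCl fun z hz => hC z ?_
      have h1 : |(z - s).im| ≤ ε / 4 := by
        rw [← mem_sphere_iff_norm.1 hz]
        exact Complex.abs_im_le_norm _
      have h2 : z.im = (z - s).im + s.im := by simp
      rw [h2]
      linarith [abs_add_le (z - s).im s.im]
    have hKs : ‖K s‖ ≤ C := hC s (by linarith)
    have heq : Complex.exp s * mittagLeffler α β (-Complex.exp s) =
        β * K s + α * (deriv K s - K s) := by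
      rw [hK, mittagLeffler_eq_add_deriv hα hβ]
      simp only [K, hE]
      ring
    rw [heq]
    refine (norm_add_le _ _).trans ?_
    rw [norm_mul (β : ℂ), norm_mul (α : ℂ), Complex.norm_of_nonneg hβ.le,
      Complex.norm_of_nonneg (by linarith : 0 ≤ α)]
    have := norm_sub_le (deriv K s) (K s)
    gcongr
    linarith

/-! ### Derivatives of `G` on the real line. -/

theorem iteratedDeriv_comp_ofReal {f : ℂ → ℂ} (hf : Differentiable ℂ f) (n : ℕ) :
    iteratedDeriv n (fun x : ℝ => f x) = fun x : ℝ => iteratedDeriv n f x := by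
  induction n with
  | zero => simp
  | succ n ih =>
    ext x
    rw [iteratedDeriv_succ, ih, iteratedDeriv_succ]
    refine (HasDerivAt.comp_ofReal ?_).deriv
    exact ((hf.contDiff (n := ∞)).differentiable_iteratedDeriv n
      (by exact_mod_cast WithTop.coe_lt_top n) x).hasDerivAt

/-- The derivatives of `x ↦ exp (τ x) E_{α,β}(-exp x)` are bounded on the real line, uniformly in
`τ ∈ [0, 1]`. -/
theorem exists_norm_iteratedFDeriv_exp_mul_mittagLeffler_le {α β : ℝ} (hα : 1 < α) (hα' : α < 2)
    (hβ : 0 < β) (m : ℕ) :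
    ∃ C, ∀ τ ∈ Icc (0 : ℝ) 1, ∀ i ≤ m, ∀ x : ℝ,
      ‖iteratedFDeriv ℝ i (fun x : ℝ =>
        Complex.exp (τ * x) * mittagLeffler α β (-Complex.exp x)) x‖ ≤ C := by
  obtain ⟨ε, hε, C₁, hC₁⟩ := exists_norm_exp_mul_mittagLeffler_le hα hα' hβ
  have hEd := differentiable_mittagLeffler hα hβ
  obtain ⟨C₂, hC₂⟩ := (isCompact_closedBall (0 : ℂ) 1).exists_bound_of_continuousOn
    hEd.continuous.continuousOn
  have hC₁0 : 0 ≤ C₁ := (norm_nonneg _).trans (hC₁ 0 (by simpa using hε))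
  have hC₂0 : 0 ≤ C₂ := (norm_nonneg _).trans (hC₂ 0 (by simp))
  have hbound : ∀ τ ∈ Icc (0 : ℝ) 1, ∀ s : ℂ, |s.im| < ε →
      ‖Complex.exp (τ * s) * mittagLeffler α β (-Complex.exp s)‖ ≤ C₁ + C₂ := by
    intro τ hτ s hs
    have hexp : ‖Complex.exp (τ * s)‖ = Real.exp (τ * s.re) := by simp [Complex.norm_exp]
    -- For `Re s ≥ 0`, `τ ≤ 1` allows replacing `exp(τs)` by `exp(s)` in norm; for `Re s ≤ 0`, `-exp
    -- s` lies in the unit disc.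
    rcases le_total 0 s.re with h | h
    · refine le_trans ?_ ((hC₁ s hs).trans (le_add_of_nonneg_right hC₂0))
      rw [norm_mul, norm_mul, hexp, Complex.norm_exp]
      gcongr
      exact mul_le_of_le_one_left h hτ.2
    · rw [norm_mul, hexp]
      have h1 : Real.exp (τ * s.re) ≤ 1 :=
        Real.exp_le_one_iff.2 (mul_nonpos_of_nonneg_of_nonpos hτ.1 h)
      have h2 := hC₂ (-Complex.exp s) (by simpa [Complex.norm_exp] using h)
      calc _ ≤ 1 * C₂ := by gcongr
        _ ≤ _ := by linarith
  refine ⟨∑ i ∈ Finset.range (m + 1), i.factorial * (C₁ + C₂) / (ε / 2) ^ i,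
    fun τ hτ i hi x => ?_⟩
  let G : ℂ → ℂ := fun s => Complex.exp (τ * s) * mittagLeffler α β (-Complex.exp s)
  have hG : Differentiable ℂ G :=
    (by fun_prop : Differentiable ℂ fun s : ℂ => Complex.exp (τ * s)).mul
      (hEd.comp Complex.differentiable_exp.neg)
  have hi' : ‖iteratedDeriv i G x‖ ≤ i.factorial * (C₁ + C₂) / (ε / 2) ^ i := by
    refine Complex.norm_iteratedDeriv_le_of_forall_mem_sphere_norm_le i (by positivity)
      hG.diffContOnCl fun z hz => hbound τ hτ z ?_
    have h1 : |(z - x).im| ≤ ε / 2 := by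
      rw [← mem_sphere_iff_norm.1 hz]
      exact Complex.abs_im_le_norm _
    simp at h1
    linarith
  rw [norm_iteratedFDeriv_eq_norm_iteratedDeriv]
  have := congrFun (iteratedDeriv_comp_ofReal hG i) x
  simp only [G] at this hi'
  rw [this]
  refine hi'.trans (Finset.single_le_sum
    (f := fun i : ℕ => (i.factorial : ℝ) * (C₁ + C₂) / (ε / 2) ^ i)
    (fun j _ => by positivity) (Finset.mem_range.2 (by omega)))

/-! ### Multi-index derivatives and Fréchet derivatives. -/

section MultiIndex

variable {N : ℕ} {F : Type*} [NormedAddCommGroup F] [NormedSpace ℝ F]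
  {U : Set (EuclideanSpace ℝ (Fin N))} {f : EuclideanSpace ℝ (Fin N) → F}

theorem partialDeriv_eqOn_fderivWithin (hU : IsOpen U) (hf : ContDiffOn ℝ ∞ f U) (i : Fin N) :
    EqOn (partialDeriv i f)
      (fun ξ => fderivWithin ℝ f U ξ (EuclideanSpace.single i (1 : ℝ))) U := by
  intro ξ hξ
  have hd : DifferentiableAt ℝ f ξ := (hf.contDiffAt (hU.mem_nhds hξ)).differentiableAt (by simp)
  simp only [partialDeriv]
  rw [hd.lineDeriv_eq_fderiv, fderivWithin_of_isOpen hU hξ]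

theorem contDiffOn_partialDeriv (hU : IsOpen U) (hf : ContDiffOn ℝ ∞ f U) (i : Fin N) :
    ContDiffOn ℝ ∞ (partialDeriv i f) U :=
  ((hf.fderivWithin hU.uniqueDiffOn (m := ∞) (by simp)).clm_apply contDiffOn_const).congr
    (partialDeriv_eqOn_fderivWithin hU hf i)

theorem norm_iteratedFDerivWithin_partialDeriv_le (hU : IsOpen U) (hf : ContDiffOn ℝ ∞ f U)
    (i : Fin N) (n : ℕ) {ξ : EuclideanSpace ℝ (Fin N)} (hξ : ξ ∈ U) :
    ‖iteratedFDerivWithin ℝ n (partialDeriv i f) U ξ‖ ≤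
      ‖iteratedFDerivWithin ℝ (n + 1) f U ξ‖ := by
  rw [iteratedFDerivWithin_congr (partialDeriv_eqOn_fderivWithin hU hf i) hξ,
    ← norm_iteratedFDerivWithin_fderivWithin hU.uniqueDiffOn hξ]
  have hfd : ContDiffOn ℝ ∞ (fderivWithin ℝ f U) U :=
    hf.fderivWithin hU.uniqueDiffOn (m := ∞) (by simp)
  refine (norm_iteratedFDerivWithin_clm_apply_const (hfd ξ hξ) hU.uniqueDiffOn hξ
    (by exact_mod_cast le_top)).trans ?_
  simp

theorem contDiffOn_iterate_partialDeriv (hU : IsOpen U) (hf : ContDiffOn ℝ ∞ f U) (i : Fin N)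
    (m : ℕ) : ContDiffOn ℝ ∞ ((partialDeriv i)^[m] f) U := by
  induction m with
  | zero => simpa
  | succ m ih =>
    rw [Function.iterate_succ_apply']
    exact contDiffOn_partialDeriv hU ih i

theorem norm_iteratedFDerivWithin_iterate_partialDeriv_le (hU : IsOpen U)
    (hf : ContDiffOn ℝ ∞ f U) (i : Fin N) (m n : ℕ) {ξ : EuclideanSpace ℝ (Fin N)} (hξ : ξ ∈ U) :
    ‖iteratedFDerivWithin ℝ n ((partialDeriv i)^[m] f) U ξ‖ ≤
      ‖iteratedFDerivWithin ℝ (n + m) f U ξ‖ := by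
  induction m generalizing n with
  | zero => simp
  | succ m ih =>
    rw [Function.iterate_succ_apply']
    refine (norm_iteratedFDerivWithin_partialDeriv_le hU
      (contDiffOn_iterate_partialDeriv hU hf i m) i n hξ).trans ((ih (n + 1)).trans_eq ?_)
    rw [show n + 1 + m = n + (m + 1) by ring]

theorem norm_iteratedFDerivWithin_foldr_partialDeriv_le (hU : IsOpen U)
    (hf : ContDiffOn ℝ ∞ f U) (γ : Fin N → ℕ) (l : List (Fin N)) :
    ContDiffOn ℝ ∞ (l.foldr (fun i g => (partialDeriv i)^[γ i] g) f) U ∧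
      ∀ (n : ℕ), ∀ ξ ∈ U,
        ‖iteratedFDerivWithin ℝ n (l.foldr (fun i g => (partialDeriv i)^[γ i] g) f) U ξ‖ ≤
          ‖iteratedFDerivWithin ℝ (n + (l.map γ).sum) f U ξ‖ := by
  induction l with
  | nil => exact ⟨hf, fun n ξ _ => le_rfl⟩
  | cons i l ih =>
    refine ⟨contDiffOn_iterate_partialDeriv hU ih.1 i (γ i), fun n ξ hξ => ?_⟩
    refine (norm_iteratedFDerivWithin_iterate_partialDeriv_le hU ih.1 i (γ i) n hξ).trans
      ((ih.2 _ ξ hξ).trans_eq ?_)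
    rw [List.map_cons, List.sum_cons, add_assoc]

/-- Each partial derivative evaluates one slot of a Fréchet derivative at a unit vector, so the norm
does not increase. -/
theorem norm_multiDeriv_le (hU : IsOpen U) (hf : ContDiffOn ℝ ∞ f U) (γ : Fin N → ℕ)
    {ξ : EuclideanSpace ℝ (Fin N)} (hξ : ξ ∈ U) :
    ‖multiDeriv γ f ξ‖ ≤ ‖iteratedFDerivWithin ℝ (multiLength γ) f U ξ‖ := by
  have h := (norm_iteratedFDerivWithin_foldr_partialDeriv_le hU hf γ (List.finRange N)).2 0 ξ hξ
  rwa [norm_iteratedFDerivWithin_zero, zero_add, ← Fin.sum_univ_def] at h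

theorem foldr_partialDeriv_single (i₀ : Fin N) (m : ℕ) (l : List (Fin N)) (hl : l.Nodup) :
    l.foldr (fun i g => (partialDeriv i)^[Pi.single (M := fun _ => ℕ) i₀ m i] g) f =
      if i₀ ∈ l then (partialDeriv i₀)^[m] f else f := by
  induction l with
  | nil => simp
  | cons i l ih =>
    rw [List.nodup_cons] at hl
    rw [List.foldr_cons, ih hl.2]
    by_cases h : i = i₀
    · subst h
      simp [hl.1]
    · simp [Ne.symm h]

/-- This lets the symbol bound be tested on powers of a single partial derivative. -/
theorem multiDeriv_single (i₀ : Fin N) (m : ℕ) :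
    multiDeriv (Pi.single i₀ m) f = (partialDeriv i₀)^[m] f := by
  have := foldr_partialDeriv_single (f := f) i₀ m (List.finRange N) (List.nodup_finRange N)
  simpa [multiDeriv] using this

theorem multiLength_single (i₀ : Fin N) (m : ℕ) : multiLength (Pi.single i₀ m) = m := by
  simp [multiLength]

end MultiIndex

/-! ### Lower bound for the symbol constant. -/

section Homogeneous

variable {N : ℕ} {k : ℝ} {σ : EuclideanSpace ℝ (Fin N) → ℝ}

/-- On the ray through a basis vector, that partial derivative is `d/dt` acting on a multiple of
`t^k`. Only `t = 1` is used later, but the induction needs the whole ray. -/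
theorem HomogeneousOfDegree.iterate_partialDeriv (hσ : HomogeneousOfDegree k σ) (i : Fin N)
    (m : ℕ) {t : ℝ} (ht : 0 < t) :
    (partialDeriv i)^[m] σ (t • EuclideanSpace.single i (1 : ℝ)) =
      (∏ j ∈ Finset.range m, (k - j)) * t ^ (k - m) * σ (EuclideanSpace.single i (1 : ℝ)) := by
  induction m generalizing t with
  | zero => simp [hσ t ht (EuclideanSpace.single i (1 : ℝ)) (by simp)]
  | succ m ih =>
    rw [Function.iterate_succ_apply']
    simp only [partialDeriv, lineDeriv]
    have hev : (fun r : ℝ => (partialDeriv i)^[m] σ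
          (t • EuclideanSpace.single i (1 : ℝ) + r • EuclideanSpace.single i (1 : ℝ))) =ᶠ[𝓝 0]
        fun r => (∏ j ∈ Finset.range m, (k - j)) * (t + r) ^ (k - m) *
          σ (EuclideanSpace.single i (1 : ℝ)) := by
      filter_upwards [Ioi_mem_nhds (by linarith : -t < 0)] with r hr
      rw [← add_smul, ih (by linarith [mem_Ioi.1 hr])]
    have hd : HasDerivAt (fun r : ℝ => (∏ j ∈ Finset.range m, (k - j)) * (t + r) ^ (k - m) *
          σ (EuclideanSpace.single i (1 : ℝ)))
        ((∏ j ∈ Finset.range m, (k - j)) * (1 * (k - m) * (t + 0) ^ (k - m - 1)) *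
          σ (EuclideanSpace.single i (1 : ℝ))) 0 :=
      ((((hasDerivAt_id (0 : ℝ)).const_add t).rpow_const
        (Or.inl (by simpa using ht.ne'))).const_mul _).mul_const _
    rw [hev.deriv_eq, hd.deriv, Finset.prod_range_succ]
    push_cast
    rw [add_zero, show k - m - 1 = k - (m + 1) by ring]
    ring

/-- If `k ≤ m` the first bound is immediate. If `k ≥ m`, each factor satisfies `(m+1)(k-j) ≥
(m+1)(k-m+1) = 1 + k + m(k-m)`. -/
theorem pow_le_prod_sub_or (hk : 0 < k) (m : ℕ) :
    (1 + k) ^ m ≤ (m + 1) ^ m ∨ (1 + k) ^ m ≤ (m + 1) ^ m * ∏ j ∈ Finset.range m, (k - j) := by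
  rcases le_total k m with h | h
  · exact Or.inl (pow_le_pow_left₀ (by positivity) (by linarith) m)
  · right
    have : (1 + k) ^ m = ∏ _j ∈ Finset.range m, (1 + k) := by simp
    rw [this, show ((m : ℝ) + 1) ^ m = ∏ _j ∈ Finset.range m, ((m : ℝ) + 1) by simp,
      ← Finset.prod_mul_distrib]
    refine Finset.prod_le_prod (fun _ _ => by positivity) fun j hj => ?_
    have hj' : (j : ℝ) + 1 ≤ m := by exact_mod_cast Finset.mem_range.1 hj
    have hm : (0 : ℝ) ≤ m := m.cast_nonneg
    nlinarith [mul_nonneg hm (sub_nonneg.2 h)]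

/-- Symbol bounds for a homogeneous function force the constant to grow like the top power of the
degree. -/
theorem pow_mul_le_of_symbolBound {A : ℝ} (hk : 0 < k) (hσ : HomogeneousOfDegree k σ)
    (hA : SymbolBound k A σ) (i : Fin N) (hpos : 0 < σ (EuclideanSpace.single i (1 : ℝ))) :
    (1 + k) ^ (N / 2 + 1) * σ (EuclideanSpace.single i (1 : ℝ)) ≤
      (((N / 2 + 1 : ℕ) : ℝ) + 1) ^ (N / 2 + 1) * A := by
  have h : ∀ m ≤ N / 2 + 1,
      (∏ j ∈ Finset.range m, (k - j)) * σ (EuclideanSpace.single i (1 : ℝ)) ≤ A := by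
    intro m hm
    have h1 := hA (Pi.single i m) (by rwa [multiLength_single])
      (EuclideanSpace.single i (1 : ℝ)) (by simp)
    have h2 := hσ.iterate_partialDeriv i m one_pos
    rw [one_smul, Real.one_rpow, mul_one] at h2
    rw [multiDeriv_single, h2] at h1
    simpa using (le_abs_self _).trans h1
  -- Order zero handles small `k`, where the falling factorial may vanish or be negative; order
  -- `[N/2] + 1` handles large `k`.
  have h0 := h 0 (Nat.zero_le _)
  rw [Finset.prod_range_zero, one_mul] at h0
  rcases pow_le_prod_sub_or hk (N / 2 + 1) with h' | h'
  · gcongr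
  · refine (mul_le_mul_of_nonneg_right h' hpos.le).trans ?_
    rw [mul_assoc]
    gcongr
    exact h _ le_rfl

end Homogeneous

/-! ### Chain rule and scaling estimates. -/

section Calculus

variable {E : Type*} [NormedAddCommGroup E] [NormedSpace ℝ E]

theorem contDiff_comp_ofReal {f : ℂ → ℂ} (hf : Differentiable ℂ f) :
    ContDiff ℝ ∞ fun x : ℝ => f x :=
  ((hf.contDiff (n := ∞)).restrict_scalars ℝ).comp Complex.ofRealCLM.contDiff

theorem norm_iteratedFDeriv_exp_neg_mul_le {τ : ℝ} (hτ : τ ∈ Icc (0 : ℝ) 1) (i : ℕ) {x B : ℝ}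
    (hx : |x| ≤ B) :
    ‖iteratedFDeriv ℝ i (fun x : ℝ => Complex.exp (-τ * x)) x‖ ≤ Real.exp B := by
  rw [norm_iteratedFDeriv_eq_norm_iteratedDeriv,
    congrFun (iteratedDeriv_comp_ofReal (f := fun s : ℂ => Complex.exp (-τ * s)) (by fun_prop) i) x,
    iteratedDeriv_cexp_const_mul, norm_mul, norm_pow, norm_neg, Complex.norm_of_nonneg hτ.1,
    Complex.norm_exp]
  have h1 : τ ^ i ≤ 1 := pow_le_one₀ hτ.1 hτ.2
  have h2 : (-(τ : ℂ) * x).re ≤ B := by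
    simp only [← Complex.ofReal_neg, ← Complex.ofReal_mul, Complex.ofReal_re]
    nlinarith [neg_abs_le x, abs_nonneg x, hτ.1, hτ.2]
  calc _ ≤ 1 * Real.exp B := by gcongr
    _ = _ := one_mul _

theorem exists_norm_iteratedFDerivWithin_le_of_isCompact {U K : Set E} (hU : IsOpen U)
    (hK : IsCompact K) (hKU : K ⊆ U) {f : E → ℝ} (hf : ContDiffOn ℝ ∞ f U) (m : ℕ) :
    ∃ B, ∀ i ≤ m, ∀ x ∈ K, ‖iteratedFDerivWithin ℝ i f U x‖ ≤ B := by
  have h : ∀ i : ℕ, ∃ B, ∀ x ∈ K, ‖iteratedFDerivWithin ℝ i f U x‖ ≤ B := fun i =>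
    hK.exists_bound_of_continuousOn ((hf.continuousOn_iteratedFDerivWithin
      (by exact_mod_cast le_top) hU.uniqueDiffOn).mono hKU)
  choose B hB using h
  refine ⟨∑ i ∈ Finset.range (m + 1), |B i|, fun i hi x hx => ?_⟩
  exact (hB i x hx).trans ((le_abs_self _).trans (Finset.single_le_sum
    (f := fun i => |B i|) (fun _ _ => abs_nonneg _) (Finset.mem_range.2 (by omega))))

/-- Derivatives of `exp (-τ φ) G(k ρ + φ + c)` at a point where those of `ρ` and `φ` are bounded by
`B` and those of `G` are bounded by `C` everywhere. -/
theorem norm_iteratedFDerivWithin_exp_mul_comp_le {U : Set E} (hU : IsOpen U) {ρ φ : E → ℝ}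
    (hρ : ContDiffOn ℝ ∞ ρ U) (hφ : ContDiffOn ℝ ∞ φ U) {G : ℝ → ℂ} (hG : ContDiff ℝ ∞ G)
    {M : ℕ} {B C k τ c : ℝ} (hB : 1 ≤ B) (hk : 0 < k) (hτ : τ ∈ Icc (0 : ℝ) 1)
    (hGC : ∀ i ≤ M, ∀ x, ‖iteratedFDeriv ℝ i G x‖ ≤ C) {u : E} (hu : u ∈ U)
    (hρB : ∀ i ≤ M, ‖iteratedFDerivWithin ℝ i ρ U u‖ ≤ B)
    (hφB : ∀ i ≤ M, ‖iteratedFDerivWithin ℝ i φ U u‖ ≤ B) {n : ℕ} (hn : n ≤ M) :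
    ‖iteratedFDerivWithin ℝ n
      (fun ξ => Complex.exp (-τ * φ ξ) * G (k * ρ ξ + φ ξ + c)) U u‖ ≤
      2 ^ M * ((M.factorial * Real.exp B * B ^ M) * (M.factorial * C * B ^ M)) *
        (1 + k) ^ M := by
  have hC : 0 ≤ C := (norm_nonneg _).trans (hGC 0 (Nat.zero_le _) 0)
  have hinf : ∀ i : ℕ, (i : ℕ∞ω) ≤ ∞ := fun i => by exact_mod_cast le_top
  have hexp : ContDiff ℝ ∞ fun x : ℝ => Complex.exp (-τ * x) :=
    contDiff_comp_ofReal (f := fun s : ℂ => Complex.exp (-τ * s)) (by fun_prop)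
  have hφ0 : |φ u| ≤ B := by
    have := hφB 0 (Nat.zero_le _)
    rwa [norm_iteratedFDerivWithin_zero] at this
  have h1 : ∀ i ≤ M, ‖iteratedFDerivWithin ℝ i (fun ξ => Complex.exp (-τ * φ ξ)) U u‖ ≤
      M.factorial * Real.exp B * B ^ M := by
    intro i hi
    refine (norm_iteratedFDerivWithin_comp_le (g := fun x : ℝ => Complex.exp (-τ * x))
      (t := univ) (D := B) (C := Real.exp B) hexp.contDiffOn hφ (hinf i) uniqueDiffOn_univ
      hU.uniqueDiffOn (mapsTo_univ _ _) hu (fun j _ => ?_) (fun j hj hji => ?_)).trans ?_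
    · rw [iteratedFDerivWithin_univ]
      exact norm_iteratedFDeriv_exp_neg_mul_le hτ j hφ0
    · exact (hφB j (hji.trans hi)).trans (le_self_pow₀ hB (by omega))
    · gcongr
  -- The composition estimate wants the `j`-th inner derivative below `D^j`; with `D = (1 + k)B ≥ 1`
  -- a bound by `D` suffices for `j ≥ 1`.
  have hkB : 1 ≤ (1 + k) * B := by nlinarith
  have hGc : ContDiff ℝ ∞ fun x => G (x + c) := hG.comp (contDiff_id.add contDiff_const)
  have hin : ContDiffOn ℝ ∞ (k • ρ + φ) U := (contDiffOn_const.smul hρ).add hφ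
  have h2 : ∀ i ≤ M, ‖iteratedFDerivWithin ℝ i (fun ξ => G (k * ρ ξ + φ ξ + c)) U u‖ ≤
      M.factorial * C * B ^ M * (1 + k) ^ M := by
    intro i hi
    refine (norm_iteratedFDerivWithin_comp_le (g := fun x : ℝ => G (x + c)) (f := k • ρ + φ)
      (t := univ) (D := (1 + k) * B) (C := C) hGc.contDiffOn hin (hinf i) uniqueDiffOn_univ
      hU.uniqueDiffOn (mapsTo_univ _ _) hu (fun j hj => ?_) (fun j hj hji => ?_)).trans ?_
    · rw [iteratedFDerivWithin_univ, iteratedFDeriv_comp_add_right]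
      exact hGC j (hj.trans hi) _
    · have hρj := (hρ.of_le (hinf j)) u hu
      have hkρ : ContDiffWithinAt ℝ j (k • ρ) U u := contDiffWithinAt_const.smul hρj
      rw [iteratedFDerivWithin_add_apply hkρ ((hφ.of_le (hinf j)) u hu) hU.uniqueDiffOn hu,
        iteratedFDerivWithin_const_smul_apply hρj hU.uniqueDiffOn hu]
      refine le_trans ?_ (le_self_pow₀ hkB (by omega))
      refine (norm_add_le _ _).trans ?_
      rw [norm_smul, Real.norm_of_nonneg hk.le]
      have := mul_le_mul_of_nonneg_left (hρB j (hji.trans hi)) hk.le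
      linarith [hφB j (hji.trans hi)]
    · calc (i.factorial : ℝ) * C * ((1 + k) * B) ^ i
          ≤ M.factorial * C * ((1 + k) * B) ^ M := by
            gcongr
        _ = _ := by rw [mul_pow]; ring
  refine (norm_iteratedFDerivWithin_mul_le (hexp.comp_contDiffOn hφ)
    (hGc.comp_contDiffOn hin) hU.uniqueDiffOn hu (hinf n)).trans ?_
  calc ∑ i ∈ Finset.range (n + 1), (n.choose i : ℝ) *
        ‖iteratedFDerivWithin ℝ i (fun ξ => Complex.exp (-τ * φ ξ)) U u‖ *
        ‖iteratedFDerivWithin ℝ (n - i) (fun ξ => G (k * ρ ξ + φ ξ + c)) U u‖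
      ≤ ∑ i ∈ Finset.range (n + 1), (n.choose i : ℝ) *
          (M.factorial * Real.exp B * B ^ M) * (M.factorial * C * B ^ M * (1 + k) ^ M) := by
        refine Finset.sum_le_sum fun i hi => ?_
        have hi' := Finset.mem_range.1 hi
        gcongr
        · exact h1 i (by omega)
        · exact h2 (n - i) (by omega)
    _ = 2 ^ n * ((M.factorial * Real.exp B * B ^ M) * (M.factorial * C * B ^ M)) *
          (1 + k) ^ M := by
        rw [← Finset.sum_mul, ← Finset.sum_mul]
        have : ∑ i ∈ Finset.range (n + 1), (n.choose i : ℝ) = 2 ^ n := by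
          exact_mod_cast Nat.sum_range_choose n
        rw [this]
        ring
    _ ≤ _ := by
        gcongr
        norm_num

/-- Each derivative of the dilation costs a factor `r⁻¹`; with `r = |ξ|` this is the source of the
decay `|ξ|^(-|γ|)`. -/
theorem norm_iteratedFDerivWithin_comp_inv_smul_le {f : E → ℂ} (hf : ContDiffOn ℝ ∞ f {0}ᶜ)
    {r : ℝ} (hr : 0 < r) {ξ : E} (hξ : ξ ≠ 0) (n : ℕ) :
    ‖iteratedFDerivWithin ℝ n (fun η => f (r⁻¹ • η)) {0}ᶜ ξ‖ ≤
      ‖iteratedFDerivWithin ℝ n f {0}ᶜ (r⁻¹ • ξ)‖ * r⁻¹ ^ n := by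
  let g : E →L[ℝ] E := r⁻¹ • ContinuousLinearMap.id ℝ E
  have hpre : g ⁻¹' {0}ᶜ = {0}ᶜ := by
    ext η
    simp [g, hr.ne']
  have hg : ‖g‖ ≤ r⁻¹ :=
    ContinuousLinearMap.opNorm_le_bound _ (by positivity) fun η => by
      simp [g, norm_smul, abs_of_pos hr]
  have hu : UniqueDiffOn ℝ ({0}ᶜ : Set E) := isOpen_compl_singleton.uniqueDiffOn
  have key := g.iteratedFDerivWithin_comp_right hf hu (by rwa [hpre]) (x := ξ)
    (by simp [g, hr.ne', hξ]) (i := n) (by exact_mod_cast le_top)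
  rw [hpre] at key
  have : (fun η => f (r⁻¹ • η)) = f ∘ g := by ext η; simp [g]
  rw [this, key]
  refine (ContinuousMultilinearMap.norm_compContinuousLinearMap_le _ _).trans ?_
  rw [Finset.prod_const, Finset.card_univ, Fintype.card_fin]
  have hgx : g ξ = r⁻¹ • ξ := by simp [g]
  rw [hgx]
  gcongr

end Calculus

/-! ### Logarithmic coordinates for the symbol. -/

section Symbol

variable {N : ℕ}

theorem contDiffOn_norm_rpow_mul_mittagLeffler {α β δ : ℝ} (hα : 1 < α) (hβ : 0 < β)
    {σ : EuclideanSpace ℝ (Fin N) → ℝ} (hσ : ContDiffOn ℝ ∞ σ {0}ᶜ) :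
    ContDiffOn ℝ ∞ (fun ξ : EuclideanSpace ℝ (Fin N) =>
      ((‖ξ‖ ^ δ : ℝ) : ℂ) * mittagLeffler α β (-(σ ξ : ℂ))) {0}ᶜ := by
  have hnorm : ContDiffOn ℝ ∞ (fun ξ : EuclideanSpace ℝ (Fin N) => ‖ξ‖ ^ δ) {0}ᶜ :=
    (contDiffOn_id.norm ℝ fun ξ hξ => hξ).rpow_const_of_ne fun ξ hξ => norm_ne_zero_iff.2 hξ
  refine (Complex.ofRealCLM.contDiff.comp_contDiffOn hnorm).mul ?_
  exact (contDiff_comp_ofReal (f := fun z => mittagLeffler α β (-z))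
    ((differentiable_mittagLeffler hα hβ).comp differentiable_neg)).comp_contDiffOn hσ

theorem HomogeneousOfDegree.log_smul {k : ℝ} {σ : EuclideanSpace ℝ (Fin N) → ℝ}
    (hσ : HomogeneousOfDegree k σ) (hpos : ∀ ξ, ξ ≠ 0 → 0 < σ ξ) {r : ℝ} (hr : 0 < r)
    {ξ : EuclideanSpace ℝ (Fin N)} (hξ : ξ ≠ 0) :
    Real.log (σ (r • ξ)) = k * Real.log r + Real.log (σ ξ) := by
  rw [hσ r hr ξ hξ, Real.log_mul (Real.rpow_pos_of_pos hr k).ne' (hpos ξ hξ).ne',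
    Real.log_rpow hr]

/-- The right side sees `σ` only on the unit sphere, so the angular logarithm is determined by `θ`,
whatever the degree. -/
theorem HomogeneousOfDegree.log_sub_log_norm {k : ℝ} {σ : EuclideanSpace ℝ (Fin N) → ℝ}
    (hσ : HomogeneousOfDegree k σ) (hpos : ∀ ξ, ξ ≠ 0 → 0 < σ ξ)
    {ξ : EuclideanSpace ℝ (Fin N)} (hξ : ξ ≠ 0) :
    Real.log (σ ξ) - k * Real.log ‖ξ‖ = Real.log (σ (‖ξ‖⁻¹ • ξ)) := by
  have hn : 0 < ‖ξ‖ := norm_pos_iff.2 hξ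
  rw [hσ.log_smul hpos (inv_pos.2 hn) hξ, Real.log_inv]
  ring

/-- The function `|ξ|^δ E_{α,β}(-σ(ξ))` in logarithmic coordinates, with the dilation by `r`
separated off; `φ` is the logarithm of the angular part of `σ`. -/
theorem norm_rpow_mul_mittagLeffler_eq {α β k δ : ℝ} (hk : 0 < k)
    {σ φ : EuclideanSpace ℝ (Fin N) → ℝ} (hσ : HomogeneousOfDegree k σ)
    (hpos : ∀ ξ, ξ ≠ 0 → 0 < σ ξ)
    (hφ : ∀ ξ, ξ ≠ 0 → φ ξ = Real.log (σ ξ) - k * Real.log ‖ξ‖) {r : ℝ} (hr : 0 < r)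
    {ξ : EuclideanSpace ℝ (Fin N)} (hξ : ξ ≠ 0) :
    ((‖r • ξ‖ ^ δ : ℝ) : ℂ) * mittagLeffler α β (-(σ (r • ξ) : ℂ)) =
      Complex.exp (-((δ / k : ℝ) : ℂ) * φ ξ) *
        (Complex.exp ((δ / k : ℝ) * ((k * Real.log ‖ξ‖ + φ ξ + k * Real.log r : ℝ) : ℂ)) *
          mittagLeffler α β
            (-Complex.exp ((k * Real.log ‖ξ‖ + φ ξ + k * Real.log r : ℝ) : ℂ))) := by
  have hn : 0 < ‖ξ‖ := norm_pos_iff.2 hξ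
  have hr' : r • ξ ≠ 0 := smul_ne_zero hr.ne' hξ
  have h1 : k * Real.log ‖ξ‖ + φ ξ + k * Real.log r = Real.log (σ (r • ξ)) := by
    rw [hσ.log_smul hpos hr hξ, hφ ξ hξ]
    ring
  have h2 : ‖r • ξ‖ ^ δ =
      Real.exp (-(δ / k) * φ ξ + δ / k * (k * Real.log ‖ξ‖ + φ ξ + k * Real.log r)) := by
    rw [Real.rpow_def_of_pos (norm_pos_iff.2 hr'), norm_smul, Real.norm_of_nonneg hr.le,
      Real.log_mul hr.ne' hn.ne']
    congr 1
    field_simp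
    ring
  rw [← mul_assoc, ← Complex.exp_add, h2, h1, ← Complex.ofReal_exp (Real.log _),
    Real.exp_log (hpos _ hr')]
  push_cast
  rfl

end Symbol

/-! ### Assembly of the estimate. -/

theorem proposition4p3 (N : ℕ) (α β : ℝ) (hα₁ : 1 < α) (hα₂ : α < 2) (hβ : 0 < β)
    (θ : Metric.sphere (0 : EuclideanSpace ℝ (Fin N)) 1 → ℝ) :
    ∃ C : ℝ, 0 < C ∧
      ∀ (k δ A : ℝ) (σ : EuclideanSpace ℝ (Fin N) → ℝ),
        0 < k →
        ContDiffOn ℝ ∞ σ {0}ᶜ →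
        (∀ ξ, ξ ≠ 0 → 0 < σ ξ) →
        HomogeneousOfDegree k σ →
        (∀ u : Metric.sphere (0 : EuclideanSpace ℝ (Fin N)) 1, σ u = θ u) →
        SymbolBound k A σ →
        0 ≤ δ → k * (β / α - 1 / α) ≤ δ → δ < k →
          ContDiffOn ℝ ∞
            (fun ξ : EuclideanSpace ℝ (Fin N) =>
              ((‖ξ‖ ^ δ : ℝ) : ℂ) * mittagLeffler α β (-(σ ξ : ℂ))) {0}ᶜ ∧
          ∀ γ : Fin N → ℕ, multiLength γ ≤ N / 2 + 1 →
            ∀ ξ : EuclideanSpace ℝ (Fin N), ξ ≠ 0 →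
              ‖multiDeriv γ
                  (fun η : EuclideanSpace ℝ (Fin N) =>
                    ((‖η‖ ^ δ : ℝ) : ℂ) * mittagLeffler α β (-(σ η : ℂ))) ξ‖
                ≤ C * A * ‖ξ‖ ^ (-(multiLength γ : ℝ)) := by
  rcases isEmpty_or_nonempty (Fin N) with hN | ⟨⟨i₀⟩⟩
  · exact ⟨1, one_pos, fun k δ A σ _ hσ _ _ _ _ _ _ _ =>
      ⟨contDiffOn_norm_rpow_mul_mittagLeffler hα₁ hβ hσ,
        fun γ _ ξ hξ => absurd (Subsingleton.elim ξ 0) hξ⟩⟩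
  -- The constant must be fixed before `σ`. Any admissible extension `σ₀` of `θ` supplies `φ`; if
  -- there is none, the claim is vacuous.
  by_cases hex : ∃ (k₀ : ℝ) (σ₀ : EuclideanSpace ℝ (Fin N) → ℝ), ContDiffOn ℝ ∞ σ₀ {0}ᶜ ∧
      (∀ ξ, ξ ≠ 0 → 0 < σ₀ ξ) ∧ HomogeneousOfDegree k₀ σ₀ ∧
      ∀ u : Metric.sphere (0 : EuclideanSpace ℝ (Fin N)) 1, σ₀ u = θ u
  swap
  · exact ⟨1, one_pos, fun k δ A σ _ hσ hpos hhom hθ _ _ _ _ =>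
      absurd ⟨k, σ, hσ, hpos, hhom, hθ⟩ hex⟩
  obtain ⟨k₀, σ₀, hσ₀, hpos₀, hhom₀, hθ₀⟩ := hex
  set M := N / 2 + 1 with hM
  have hU : IsOpen ({0}ᶜ : Set (EuclideanSpace ℝ (Fin N))) := isOpen_compl_singleton
  let ρ : EuclideanSpace ℝ (Fin N) → ℝ := fun ξ => Real.log ‖ξ‖
  let φ : EuclideanSpace ℝ (Fin N) → ℝ := fun ξ => Real.log (σ₀ ξ) - k₀ * Real.log ‖ξ‖
  have hρ : ContDiffOn ℝ ∞ ρ {0}ᶜ :=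
    (contDiffOn_id.norm ℝ fun ξ hξ => hξ).log fun ξ hξ => norm_ne_zero_iff.2 hξ
  have hφ : ContDiffOn ℝ ∞ φ {0}ᶜ :=
    (hσ₀.log fun ξ hξ => (hpos₀ ξ hξ).ne').sub (contDiffOn_const.mul hρ)
  have hsph : Metric.sphere (0 : EuclideanSpace ℝ (Fin N)) 1 ⊆ {0}ᶜ := fun u hu =>
    ne_zero_of_mem_unit_sphere ⟨u, hu⟩
  obtain ⟨B₁, hB₁⟩ := exists_norm_iteratedFDerivWithin_le_of_isCompact hU
    (isCompact_sphere (0 : EuclideanSpace ℝ (Fin N)) 1) hsph hρ M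
  obtain ⟨B₂, hB₂⟩ := exists_norm_iteratedFDerivWithin_le_of_isCompact hU
    (isCompact_sphere (0 : EuclideanSpace ℝ (Fin N)) 1) hsph hφ M
  obtain ⟨C₁, hC₁⟩ := exists_norm_iteratedFDeriv_exp_mul_mittagLeffler_le hα₁ hα₂ hβ M
  set B := max 1 (max B₁ B₂) with hB
  set C₀ := max 1 C₁ with hC₀
  have hB1 : 1 ≤ B := le_max_left _ _
  have hC01 : 0 < C₀ := one_pos.trans_le (le_max_left _ _)
  set e : EuclideanSpace ℝ (Fin N) := EuclideanSpace.single i₀ (1 : ℝ) with he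
  have he0 : e ≠ 0 := by simp [he]
  have hes : e ∈ Metric.sphere (0 : EuclideanSpace ℝ (Fin N)) 1 := by simp [he]
  have hσe := hpos₀ e he0
  set D := 2 ^ M * ((M.factorial * Real.exp B * B ^ M) * (M.factorial * C₀ * B ^ M)) with hD
  have hD0 : 0 < D := by positivity
  -- `D` comes from the chain rule; the other factor converts `(1 + k)^M` into `A`, with `σ₀ e =
  -- θ(e)`.
  refine ⟨D * (((M : ℝ) + 1) ^ M / σ₀ e), by positivity, ?_⟩
  intro k δ A σ hk hσ hpos hhom hθ hA hδ _ hδk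
  have hsmooth := contDiffOn_norm_rpow_mul_mittagLeffler (δ := δ) hα₁ hβ hσ
  refine ⟨hsmooth, fun γ hγ ξ hξ => ?_⟩
  have hφσ : ∀ ξ, ξ ≠ 0 → φ ξ = Real.log (σ ξ) - k * Real.log ‖ξ‖ := by
    intro ξ hξ
    have hu : ‖ξ‖⁻¹ • ξ ∈ Metric.sphere (0 : EuclideanSpace ℝ (Fin N)) 1 := by
      simp [norm_smul, norm_ne_zero_iff.2 hξ]
    rw [hhom.log_sub_log_norm hpos hξ, hθ ⟨_, hu⟩, ← hθ₀ ⟨_, hu⟩]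
    exact hhom₀.log_sub_log_norm hpos₀ hξ
  set r := ‖ξ‖ with hr
  have hr0 : 0 < r := norm_pos_iff.2 hξ
  set τ := δ / k with hτdef
  have hτ : τ ∈ Icc (0 : ℝ) 1 := ⟨by positivity, (div_le_one hk).2 hδk.le⟩
  let G : ℝ → ℂ := fun x => Complex.exp (τ * x) * mittagLeffler α β (-Complex.exp x)
  have hG : ContDiff ℝ ∞ G :=
    contDiff_comp_ofReal (f := fun s : ℂ => Complex.exp (τ * s) *
      mittagLeffler α β (-Complex.exp s))
      ((by fun_prop : Differentiable ℂ fun s : ℂ => Complex.exp (τ * s)).mul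
        ((differentiable_mittagLeffler hα₁ hβ).comp Complex.differentiable_exp.neg))
  -- Here `r = |ξ|` is frozen, so that `h` is differentiated at the unit vector `r⁻¹ • ξ`, where the
  -- compactness bounds on `ρ` and `φ` hold.
  let h : EuclideanSpace ℝ (Fin N) → ℂ := fun η =>
    Complex.exp (-τ * φ η) * G (k * ρ η + φ η + k * Real.log r)
  have hfh : EqOn (fun η : EuclideanSpace ℝ (Fin N) =>
      ((‖η‖ ^ δ : ℝ) : ℂ) * mittagLeffler α β (-(σ η : ℂ))) (fun η => h (r⁻¹ • η)) {0}ᶜ := by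
    intro η hη
    have hη' : r⁻¹ • η ≠ 0 := smul_ne_zero (inv_ne_zero hr0.ne') hη
    have := norm_rpow_mul_mittagLeffler_eq (α := α) (β := β) (δ := δ) hk hhom hpos hφσ hr0 hη'
    rw [smul_inv_smul₀ hr0.ne'] at this
    exact this
  have hhs : ContDiffOn ℝ ∞ h {0}ᶜ := by
    refine ContDiffOn.mul ?_ (hG.comp_contDiffOn
      (((contDiffOn_const.mul hρ).add hφ).add contDiffOn_const))
    exact (contDiff_comp_ofReal (f := fun s : ℂ => Complex.exp (-τ * s))
      (by fun_prop)).comp_contDiffOn hφ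
  have hu : r⁻¹ • ξ ∈ Metric.sphere (0 : EuclideanSpace ℝ (Fin N)) 1 := by
    simp [norm_smul, hr, norm_ne_zero_iff.2 hξ]
  have hbound := norm_iteratedFDerivWithin_exp_mul_comp_le (c := k * Real.log r) hU hρ hφ hG
    (C := C₀) hB1 hk hτ (fun i hi x => (hC₁ τ hτ i hi x).trans (le_max_right _ _)) (hsph hu)
    (fun i hi => (hB₁ i hi _ hu).trans ((le_max_left _ _).trans (le_max_right _ _)))
    (fun i hi => (hB₂ i hi _ hu).trans ((le_max_right _ _).trans (le_max_right _ _))) hγ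
  have hlow := pow_mul_le_of_symbolBound hk hhom hA i₀ (hpos _ he0)
  rw [← he, ← hM, hθ ⟨e, hes⟩, ← hθ₀ ⟨e, hes⟩] at hlow
  have hlow' : (1 + k) ^ M ≤ ((M : ℝ) + 1) ^ M / σ₀ e * A := by
    rw [div_mul_eq_mul_div, le_div_iff₀ hσe]
    exact hlow
  calc _ ≤ ‖iteratedFDerivWithin ℝ (multiLength γ) _ {0}ᶜ ξ‖ := norm_multiDeriv_le hU hsmooth γ hξ
    _ ≤ ‖iteratedFDerivWithin ℝ (multiLength γ) h {0}ᶜ (r⁻¹ • ξ)‖ * r⁻¹ ^ multiLength γ := by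
      rw [iteratedFDerivWithin_congr hfh hξ]
      exact norm_iteratedFDerivWithin_comp_inv_smul_le hhs hr0 hξ _
    _ ≤ D * (((M : ℝ) + 1) ^ M / σ₀ e * A) * r⁻¹ ^ multiLength γ := by
      gcongr
      exact hbound.trans (by gcongr)
    _ = _ := by
      rw [Real.rpow_neg hr0.le, Real.rpow_natCast, inv_pow]
      ring
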